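/- For a group $G$ write $[x,y]=xyx^{-1}y^{-1}$ and let $G'$ be the subgroup generated by all commutators. Let $F$ be the free group on two generators, $M=F/F''$ the free metabelian group of rank $2$, and $\widehat M$ its profinite completion (the free profinite metabelian group of rank $2$), with derived subgroup $\widehat M'$ and profinite abelianization $\widehat A$. Let $\widehat{\mathbb Z}[[\widehat A]]=\varprojlim_{n,U}(\mathbb Z/n)[\widehat A/U]$ be the completed group algebra, where $n$ runs over the positive integers and $U$ over the open normal subgroups of $\widehat A$, with its inverse limit topology. Then $\widehat M'$ is a closed abelian subgroup of $\widehat M$, and the conjugation action of $\widehat M$ on it extends to a unique $\widehat{\mathbb Z}[[\widehat A]]$-module structure on $\widehat M'$ whose scalar multiplication $\widehat{\mathbb Z}[[\widehat A]]\times\widehat M'\to\widehat M'$ is continuous and for which the class in $\widehat A$ of each $g\in\widehat M$ acts by $m\mapsto gmg^{-1}$. For this structure, whenever $x_1,x_2\in\widehat M$ generate $\widehat M$ topologically, $\widehat M'$ is a free $\widehat{\mathbb Z}[[\widehat A]]$-module of rank $1$ with basis the single element $[x_1,x_2]$. -/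

import Mathlib

open scoped commutatorElement

noncomputable section

/-! ### The completed group algebra over the profinite integers -/

namespace CompletedGroupAlgebra

variable (Q : Type*) [Group Q] [TopologicalSpace Q]

/-- The finite level `(ℤ/n)[Q/U]`, for `n ≥ 1` and `U` an open normal subgroup of `Q`. The rings
`ℤ/n` with `n ≥ 1` are exactly the quotients of the profinite integers by their open ideals. -/
abbrev Level (p : ℕ+ × OpenNormalSubgroup Q) : Type _ :=
  MonoidAlgebra (ZMod (p.1 : ℕ)) (Q ⧸ p.2.toSubgroup)

variable {Q}

/-- The transition map `(ℤ/m)[Q/V] → (ℤ/n)[Q/U]` for `n ∣ m` and `V ≤ U`: it reduces the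
coefficients modulo `n` and the group elements modulo `U`. -/
def transition {p q : ℕ+ × OpenNormalSubgroup Q} (hn : (p.1 : ℕ) ∣ (q.1 : ℕ))
    (hU : q.2.toSubgroup ≤ p.2.toSubgroup) : Level Q q →+* Level Q p :=
  (MonoidAlgebra.mapRingHom (Q ⧸ p.2.toSubgroup)
      (ZMod.castHom hn (ZMod (p.1 : ℕ)))).comp
    (MonoidAlgebra.mapDomainRingHom (ZMod (q.1 : ℕ))
      (QuotientGroup.map q.2.toSubgroup p.2.toSubgroup (MonoidHom.id Q) hU))

end CompletedGroupAlgebra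

open CompletedGroupAlgebra in
/-- The completed group algebra `Ẑ⟦Q⟧`, the inverse limit of the rings `(ℤ/n)[Q/U]`, realised as
the ring of compatible families. -/
def completedGroupAlgebra (Q : Type*) [Group Q] [TopologicalSpace Q] :
    Subring (∀ p : ℕ+ × OpenNormalSubgroup Q, Level Q p) where
  carrier := {r | ∀ (p q : ℕ+ × OpenNormalSubgroup Q) (hn : (p.1 : ℕ) ∣ (q.1 : ℕ))
    (hU : q.2.toSubgroup ≤ p.2.toSubgroup), transition hn hU (r q) = r p}
  mul_mem' := fun {a b} ha hb p q hn hU => by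
    rw [Pi.mul_apply, Pi.mul_apply, map_mul, ha p q hn hU, hb p q hn hU]
  one_mem' := fun p q hn hU => by rw [Pi.one_apply, Pi.one_apply, map_one]
  add_mem' := fun {a b} ha hb p q hn hU => by
    rw [Pi.add_apply, Pi.add_apply, map_add, ha p q hn hU, hb p q hn hU]
  zero_mem' := fun p q hn hU => by rw [Pi.zero_apply, Pi.zero_apply, map_zero]
  neg_mem' := fun {a} ha p q hn hU => by
    rw [Pi.neg_apply, Pi.neg_apply, map_neg, ha p q hn hU]

namespace CompletedGroupAlgebra

variable {Q : Type*} [Group Q] [TopologicalSpace Q]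

/-- The inverse limit topology: the coarsest topology for which all the projections to the
finite levels, taken with the discrete topology, are continuous. -/
instance instTopologicalSpace : TopologicalSpace (completedGroupAlgebra Q) :=
  ⨅ p : ℕ+ × OpenNormalSubgroup Q,
    TopologicalSpace.induced (fun r : completedGroupAlgebra Q => r.1 p) ⊥

/-- The canonical map from `Q` to the multiplicative monoid of `Ẑ⟦Q⟧`. -/
def of : Q →* completedGroupAlgebra Q where
  toFun a := ⟨fun p => MonoidAlgebra.of (ZMod (p.1 : ℕ)) (Q ⧸ p.2.toSubgroup)
      (QuotientGroup.mk a), fun p q hn hU => by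
    simp [transition, MonoidAlgebra.of_apply, MonoidAlgebra.mapDomain_single, ZMod.cast_one hn]
    rfl⟩
  map_one' := by
    ext1; funext p
    exact map_one (MonoidAlgebra.of (ZMod (p.1 : ℕ)) (Q ⧸ p.2.toSubgroup))
  map_mul' a b := by
    ext1; funext p
    exact map_mul (MonoidAlgebra.of (ZMod (p.1 : ℕ)) (Q ⧸ p.2.toSubgroup))
      (QuotientGroup.mk a) (QuotientGroup.mk b)

end CompletedGroupAlgebra

/-! ### The free profinite metabelian group of rank two -/

/-- The free metabelian group `M = F/F''`, where `F` is the free group on two generators. -/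
abbrev FreeMetabelian : Type :=
  FreeGroup (Fin 2) ⧸ derivedSeries (FreeGroup (Fin 2)) 2

/-- The profinite completion `M̂` of `M`. -/
abbrev MHat : ProfiniteGrp.{0} :=
  ProfiniteGrp.ProfiniteCompletion.completion (GrpCat.of FreeMetabelian)

/-- The abelianization `Â` of the profinite group `M̂`. -/
abbrev AHat : Type := TopologicalAbelianization MHat

/-- The subgroup `M̂'` of `M̂` generated (as an abstract group) by all commutators. -/
abbrev MHatDerived : Subgroup MHat := commutator MHat

lemma derivedSeries_MHat : derivedSeries MHat 2 = ⊥ := by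
  rw [eq_bot_iff]
  intro x hx
  rw [Subgroup.mem_bot]
  apply Subtype.ext
  funext H
  have hM : derivedSeries FreeMetabelian 2 = ⊥ := by
    have h := map_derivedSeries_eq
      (QuotientGroup.mk'_surjective (derivedSeries (FreeGroup (Fin 2)) 2)) 2
    rw [← h, Subgroup.map_eq_bot_iff, QuotientGroup.ker_mk']
  have hq : derivedSeries (FreeMetabelian ⧸ H.toSubgroup) 2 = ⊥ := by
    have h := map_derivedSeries_eq (QuotientGroup.mk'_surjective H.toSubgroup) 2
    rw [← h, hM, Subgroup.map_bot]
  let π : MHat →* (FreeMetabelian ⧸ H.toSubgroup) :=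
    { toFun := fun y => y.1 H, map_one' := rfl, map_mul' := fun _ _ => rfl }
  have h1 : π x ∈ derivedSeries (FreeMetabelian ⧸ H.toSubgroup) 2 :=
    map_derivedSeries_le_derivedSeries π 2 (Subgroup.mem_map_of_mem π hx)
  rw [hq, Subgroup.mem_bot] at h1
  exact h1

/-- `M̂` is metabelian: its derived subgroup is commutative. -/
instance instCommGroupMHatDerived : CommGroup MHatDerived where
  mul_comm a b := by
    have h : ⁅a.1, b.1⁆ ∈ derivedSeries MHat 2 :=
      Subgroup.commutator_mem_commutator
        (by rw [derivedSeries_one]; exact a.2) (by rw [derivedSeries_one]; exact b.2)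
    rw [derivedSeries_MHat, Subgroup.mem_bot, commutatorElement_eq_one_iff_mul_comm] at h
    exact Subtype.ext h

/-- The conjugate `g m g⁻¹` of `m ∈ M̂'` by `g ∈ M̂`, as an element of `M̂'`. -/
def conjDerived (g : MHat) (m : MHatDerived) : MHatDerived :=
  ⟨g * m.1 * g⁻¹, (inferInstance : (commutator MHat).Normal).conj_mem m.1 m.2 g⟩

/-- The commutator `[x, y] = x y x⁻¹ y⁻¹`, as an element of `M̂'`. -/
def commDerived (x y : MHat) : MHatDerived :=
  ⟨⁅x, y⁆, Subgroup.commutator_mem_commutator (Subgroup.mem_top x) (Subgroup.mem_top y)⟩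

/-- A `Ẑ⟦Â⟧`-module structure on `M̂'` (written additively) extends the conjugation action if the
scalar multiplication is jointly continuous, for the inverse limit topology on `Ẑ⟦Â⟧` and the
topology induced from `M̂` on `M̂'`, and the image in `Ẑ⟦Â⟧` of the class in `Â` of any `g ∈ M̂`
acts as conjugation by `g`. -/
def ExtendsConjugation
    (inst : Module (completedGroupAlgebra AHat) (Additive MHatDerived)) : Prop :=
  Continuous (fun z : completedGroupAlgebra AHat × Additive MHatDerived =>
      inst.toSMul.smul z.1 z.2) ∧
    ∀ (g : MHat) (m : MHatDerived),
      inst.toSMul.smul (CompletedGroupAlgebra.of (QuotientGroup.mk g : AHat)) (Additive.ofMul m) =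
        Additive.ofMul (conjDerived g m)

/-- The elements `x₁`, `x₂` generate `M̂` as a profinite group, that is, topologically. -/
def GeneratesMHat (x₁ x₂ : MHat) : Prop :=
  (Subgroup.closure ({x₁, x₂} : Set MHat)).topologicalClosure = ⊤

end

/-!
Write `Λ = Ẑ⟦Â⟧` and `c = [x₁, x₂]`.

*The derived subgroup is closed.* Let `Γ` be the dense subgroup generated by `x₁` and `x₂`. Modulo
the subgroup of products `[x₁, m][x₂, m']` with `m, m' ∈ Γ'`, the group `Γ` is nilpotent of class
two, so that `Γ'` is generated there by `c` and `c ^ n = [x₁, x₂ ^ n]`. Hence every element of `Γ'`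
has the form `[x₁, u][x₁, v][x₂, w]` (`exists_eq_of_mem_commutator`). As `M̂` is compact, the set of
all such products with `u, v, w ∈ M̂` is closed; it consists of products of commutators and contains
`Γ'`, so `M̂'` is the closure of `Γ'` (`isClosed_commutator`).

*The module structure.* A profinite abelian group `V` with a continuous action of a compact group
`Q` has a basis of neighbourhoods of `0` consisting of open `Q`-stable subgroups `W`. The action of
`Q` on the finite group `V ⧸ W` extends to `(ℤ/n)[Q/U]` for suitable `n` and `U`, and these actions
glue to a continuous action of `Ẑ⟦Q⟧` on `V` (`CompletedGroupAlgebra.module`). It is unique since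
`ℤ[Q]` is dense in `Ẑ⟦Q⟧`.

*Generation.* The set `Λ c` is compact, hence closed. It is normal in `M̂`, and `M̂ ⧸ Λ c` is
topologically generated by two commuting elements; thus `M̂' = Λ c`
(`MHat.exists_smul_commDerived_eq`).

*Freeness.* Let first `x, y` be the standard generators. For every finite level
`R = (ℤ/n)[Â/U]`, the freeness of `M̂` yields a homomorphism to `R ⋊ Â/U` with `x ↦ (1, x)` and
`y ↦ (0, y)`, which maps `λ [x, y]` to `λ (1 - y) ∈ R`. So `λ [x, y] = 0` implies `λ (1 - y) = 0`
in `Λ`, and `1 - y` is a nonzero divisor because `Â` maps onto `ℤ/N` with `y ↦ 1` for every `N`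
(`CompletedGroupAlgebra.eq_zero_of_mul_of_eq`). For an arbitrary pair of generators, the
commutators `[x₁, x₂]` and `[x, y]` are multiples of each other, hence differ by a unit of the
commutative ring `Λ`.
-/

open scoped commutatorElement

noncomputable section

/-! ### Topology of the completed group algebra -/

namespace CompletedGroupAlgebra

open Filter Topology

variable {Q : Type*} [Group Q] [TopologicalSpace Q]

/-- The projection of `Ẑ⟦Q⟧` to the finite level `p`. -/
def proj (p : ℕ+ × OpenNormalSubgroup Q) : completedGroupAlgebra Q →+* Level Q p :=
  (Pi.evalRingHom _ p).comp (completedGroupAlgebra Q).subtype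

lemma ext_proj {r s : completedGroupAlgebra Q} (h : ∀ p, proj p r = proj p s) : r = s :=
  Subtype.ext (funext h)

lemma proj_of (p : ℕ+ × OpenNormalSubgroup Q) (q : Q) :
    proj p (of q) = MonoidAlgebra.single (QuotientGroup.mk q) 1 := rfl

lemma transition_proj {p q : ℕ+ × OpenNormalSubgroup Q} (hn : (p.1 : ℕ) ∣ (q.1 : ℕ))
    (hU : q.2.toSubgroup ≤ p.2.toSubgroup) (r : completedGroupAlgebra Q) :
    transition hn hU (proj q r) = proj p r := r.2 p q hn hU

lemma transition_single {p q : ℕ+ × OpenNormalSubgroup Q} (hn : (p.1 : ℕ) ∣ (q.1 : ℕ))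
    (hU : q.2.toSubgroup ≤ p.2.toSubgroup) (g : Q) (a : ZMod (q.1 : ℕ)) :
    transition hn hU (MonoidAlgebra.single (QuotientGroup.mk g) a) =
      MonoidAlgebra.single (QuotientGroup.mk g) (ZMod.castHom hn (ZMod (p.1 : ℕ)) a) := by
  simp [transition, MonoidAlgebra.mapDomain_single]
  rfl

/-- Any two levels are dominated by a common one. -/
lemma exists_level (p q : ℕ+ × OpenNormalSubgroup Q) :
    ∃ t : ℕ+ × OpenNormalSubgroup Q, ((p.1 : ℕ) ∣ (t.1 : ℕ) ∧ t.2.toSubgroup ≤ p.2.toSubgroup) ∧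
      ((q.1 : ℕ) ∣ (t.1 : ℕ) ∧ t.2.toSubgroup ≤ q.2.toSubgroup) :=
  ⟨(p.1 * q.1, p.2 ⊓ q.2), ⟨⟨q.1, by simp⟩, inf_le_left (a := p.2) (b := q.2)⟩,
    ⟨⟨p.1, by simp [mul_comm]⟩, inf_le_right (a := p.2) (b := q.2)⟩⟩

lemma isOpen_proj_preimage (p : ℕ+ × OpenNormalSubgroup Q) (s : Set (Level Q p)) :
    IsOpen {r : completedGroupAlgebra Q | proj p r ∈ s} := by
  let _ : TopologicalSpace (Level Q p) := ⊥
  have _ : DiscreteTopology (Level Q p) := ⟨rfl⟩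
  have h : IsOpen[TopologicalSpace.induced (fun r : completedGroupAlgebra Q => r.1 p) ⊥]
      {r : completedGroupAlgebra Q | proj p r ∈ s} :=
    @IsOpen.preimage _ _ (TopologicalSpace.induced (fun r : completedGroupAlgebra Q => r.1 p) ⊥) ⊥
      _ continuous_induced_dom s (isOpen_discrete s)
  exact iInf_le (fun p : ℕ+ × OpenNormalSubgroup Q =>
    TopologicalSpace.induced (fun r : completedGroupAlgebra Q => r.1 p) ⊥) p _ h

/-- The fibres of the projections form a basis of the topology of `Ẑ⟦Q⟧`. -/
lemma exists_proj_fiber_subset {O : Set (completedGroupAlgebra Q)} (hO : IsOpen O)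
    {r : completedGroupAlgebra Q} (hr : r ∈ O) :
    ∃ p, ∀ s, proj p s = proj p r → s ∈ O := by
  have hn : 𝓝 r = ⨅ p : ℕ+ × OpenNormalSubgroup Q, 𝓟 {s | proj p s = proj p r} := by
    rw [show instTopologicalSpace = (⨅ p : ℕ+ × OpenNormalSubgroup Q, TopologicalSpace.induced
      (fun r : completedGroupAlgebra Q => r.1 p) ⊥) from rfl, nhds_iInf]
    refine iInf_congr fun p => ?_
    let _ : TopologicalSpace (Level Q p) := ⊥
    rw [nhds_induced, @nhds_discrete _ ⊥ ⟨rfl⟩, comap_pure]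
    rfl
  have hd : Directed (· ≥ ·) fun p : ℕ+ × OpenNormalSubgroup Q =>
      𝓟 {s : completedGroupAlgebra Q | proj p s = proj p r} := by
    intro p q
    obtain ⟨t, ⟨hp, hp'⟩, hq, hq'⟩ := exists_level p q
    refine ⟨t, ?_, ?_⟩ <;> refine principal_mono.2 fun s hs => ?_
    · rw [Set.mem_ofPred_eq, ← transition_proj hp hp', hs, transition_proj]
    · rw [Set.mem_ofPred_eq, ← transition_proj hq hq', hs, transition_proj]
  have h := hO.mem_nhds hr
  have : Nonempty (ℕ+ × OpenNormalSubgroup Q) := ⟨(1,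
    { (⊤ : OpenSubgroup Q) with isNormal' := Subgroup.normal_of_characteristic ⊤ })⟩
  rw [hn, mem_iInf_of_directed hd] at h
  obtain ⟨p, hp⟩ := h
  exact ⟨p, fun s hs => hp hs⟩

instance finite_level [IsTopologicalGroup Q] [CompactSpace Q] (p : ℕ+ × OpenNormalSubgroup Q) :
    Finite (Level Q p) := by
  have : Finite (Q ⧸ p.2.toSubgroup) :=
    Subgroup.quotient_finite_of_isOpen _ p.2.toOpenSubgroup.isOpen
  exact Finite.of_injective (fun x : Level Q p => (x.coeff : Q ⧸ p.2.toSubgroup → ZMod p.1))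
    (DFunLike.coe_injective.comp MonoidAlgebra.coeff_injective)

/-- `Ẑ⟦Q⟧` is closed in the product of the finite levels. -/
instance compactSpace [IsTopologicalGroup Q] [CompactSpace Q] :
    CompactSpace (completedGroupAlgebra Q) := by
  let (p : ℕ+ × OpenNormalSubgroup Q) : TopologicalSpace (Level Q p) := ⊥
  have (p : ℕ+ × OpenNormalSubgroup Q) : DiscreteTopology (Level Q p) := ⟨rfl⟩
  have hind : IsInducing (fun r : completedGroupAlgebra Q => (r.1 : ∀ p, Level Q p)) := by
    refine ⟨?_⟩
    simp only [Pi.topologicalSpace, induced_iInf, induced_compose]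
    rfl
  have hcl : IsClosed (Set.range (fun r : completedGroupAlgebra Q => (r.1 : ∀ p, Level Q p))) := by
    rw [show Set.range (fun r : completedGroupAlgebra Q => (r.1 : ∀ p, Level Q p)) =
      (completedGroupAlgebra Q : Set (∀ p, Level Q p)) from Subtype.range_val]
    simp only [completedGroupAlgebra, Subring.coe_set_mk, Subsemiring.coe_set_mk,
      Submonoid.coe_set_mk, Subsemigroup.coe_set_mk, Set.ofPred_forall]
    refine isClosed_iInter fun p => isClosed_iInter fun q => isClosed_iInter fun hn =>
      isClosed_iInter fun hU => isClosed_eq ?_ (continuous_apply p)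
    exact continuous_of_discreteTopology.comp (continuous_apply q)
  exact (IsClosedEmbedding.mk ⟨hind, Subtype.val_injective⟩ hcl).compactSpace

lemma exists_closure_proj_eq (p : ℕ+ × OpenNormalSubgroup Q) (x : Level Q p) :
    ∃ s ∈ AddSubgroup.closure (Set.range (of : Q → completedGroupAlgebra Q)), proj p s = x := by
  induction x using MonoidAlgebra.induction_linear with
  | zero => exact ⟨0, zero_mem _, map_zero _⟩
  | add x y hx hy =>
    obtain ⟨s, hs, rfl⟩ := hx
    obtain ⟨t, ht, rfl⟩ := hy
    exact ⟨s + t, add_mem hs ht, map_add _ _ _⟩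
  | single g a =>
    obtain ⟨g, rfl⟩ := QuotientGroup.mk_surjective g
    obtain ⟨a, rfl⟩ := ZMod.intCast_surjective a
    refine ⟨a • of g, zsmul_mem (AddSubgroup.subset_closure (Set.mem_range_self g)) a, ?_⟩
    rw [map_zsmul, proj_of, MonoidAlgebra.smul_single, zsmul_one]

/-- The group ring `ℤ[Q]` has dense image in `Ẑ⟦Q⟧`. -/
lemma dense_closure_range_of :
    Dense (AddSubgroup.closure (Set.range (of : Q → completedGroupAlgebra Q)) :
      Set (completedGroupAlgebra Q)) := by
  rw [dense_iff_inter_open]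
  rintro O hO ⟨r, hr⟩
  obtain ⟨p, hp⟩ := exists_proj_fiber_subset hO hr
  obtain ⟨s, hs, hs'⟩ := exists_closure_proj_eq p (proj p r)
  exact ⟨s, hp s hs', hs⟩

lemma addMonoidHom_eq_of_continuous {Y : Type*} [AddGroup Y] [TopologicalSpace Y] [T2Space Y]
    {f g : completedGroupAlgebra Q →+ Y} (hf : Continuous f) (hg : Continuous g)
    (h : ∀ q, f (of q) = g (of q)) : f = g := by
  have h1 : Set.EqOn f g (AddSubgroup.closure (Set.range (of : Q → completedGroupAlgebra Q)) :
      Set (completedGroupAlgebra Q)) :=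
    AddMonoidHom.eqOn_closure (by rintro _ ⟨q, rfl⟩; exact h q)
  exact DFunLike.coe_injective (Continuous.ext_on dense_closure_range_of hf hg h1)

lemma mul_comm_of_comm (hQ : ∀ a b : Q, a * b = b * a) (r s : completedGroupAlgebra Q) :
    r * s = s * r := by
  refine ext_proj fun p => ?_
  let : CommGroup (Q ⧸ p.2.toSubgroup) :=
    { (inferInstance : Group (Q ⧸ p.2.toSubgroup)) with
      mul_comm := by
        rintro ⟨a⟩ ⟨b⟩
        exact congrArg QuotientGroup.mk (hQ a b) }
  rw [map_mul, map_mul]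
  exact mul_comm (G := MonoidAlgebra (ZMod p.1) (Q ⧸ p.2.toSubgroup)) _ _

end CompletedGroupAlgebra

/-! ### Modules over the completed group algebra -/

namespace CompletedGroupAlgebra

open Topology

lemma isOpen_forall_of_compactSpace {X Y : Type*} [TopologicalSpace X] [TopologicalSpace Y]
    [CompactSpace X] {O : Set (X × Y)} (hO : IsOpen O) : IsOpen {y | ∀ x, (x, y) ∈ O} := by
  have h := isClosedMap_snd_of_compactSpace (X := X) (Y := Y) _ hO.isClosed_compl
  convert h.isOpen_compl using 1
  ext y
  simp

variable {Q : Type*} [Group Q] [TopologicalSpace Q]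
variable {V : Type*} [AddCommGroup V] [TopologicalSpace V]

/-- An open subgroup of `V` which is stable under the action `ρ` of `Q`. -/
structure StableOpen (ρ : Q →* AddMonoid.End V) extends OpenAddSubgroup V where
  stable : ∀ q, ∀ v ∈ toAddSubgroup, ρ q v ∈ toAddSubgroup

variable {ρ : Q →* AddMonoid.End V}

lemma end_add_apply {A : Type*} [AddCommGroup A] (f g : AddMonoid.End A) (x : A) :
    (f + g) x = f x + g x := rfl

omit [TopologicalSpace Q] [TopologicalSpace V] in
lemma end_mul_apply (ρ : Q →* AddMonoid.End V) (a b : Q) (v : V) : ρ (a * b) v = ρ a (ρ b v) := by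
  rw [map_mul]; rfl

omit [TopologicalSpace Q] [TopologicalSpace V] in
lemma end_apply_inv_apply (ρ : Q →* AddMonoid.End V) (q : Q) (v : V) : ρ q (ρ q⁻¹ v) = v := by
  rw [← end_mul_apply, mul_inv_cancel, map_one, AddMonoid.End.one_apply]

namespace StableOpen

/-- The intersection of two stable open subgroups. -/
def inf (W W' : StableOpen ρ) : StableOpen ρ where
  toOpenAddSubgroup := W.toOpenAddSubgroup ⊓ W'.toOpenAddSubgroup
  stable q v hv := ⟨W.stable q v hv.1, W'.stable q v hv.2⟩

variable [IsTopologicalAddGroup V] [CompactSpace V]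

/-- Stable open subgroups form a basis of neighbourhoods of `0`: by compactness of `Q`, the
intersection of the translates of an open subgroup is open. -/
lemma exists_subset [CompactSpace Q] [T2Space V] [TotallyDisconnectedSpace V]
    (hρ : Continuous fun z : Q × V => ρ z.1 z.2) {U : Set V} (hU : U ∈ 𝓝 0) :
    ∃ W : StableOpen ρ, (W.toAddSubgroup : Set V) ⊆ U := by
  obtain ⟨U', hU', hU'o, h0⟩ := mem_nhds_iff.1 hU
  obtain ⟨H, hH⟩ :=
    ProfiniteGrp.exist_openNormalAddSubgroup_sub_open_nhds_of_zero hU'o h0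
  have ho : IsOpen {v | ∀ q, ρ q v ∈ H.toAddSubgroup} :=
    isOpen_forall_of_compactSpace (H.toOpenAddSubgroup.isOpen.preimage hρ)
  refine ⟨⟨⟨⟨⟨⟨{v | ∀ q, ρ q v ∈ H.toAddSubgroup}, fun ha hb q => ?_⟩, fun q => ?_⟩,
    fun ha q => ?_⟩, ho⟩, fun g v hv q => ?_⟩, fun v hv => hU' (hH ?_)⟩
  · rw [map_add]; exact add_mem (ha q) (hb q)
  · rw [map_zero]; exact zero_mem _
  · rw [map_neg]; exact neg_mem (ha q)
  · rw [← end_mul_apply]; exact hv _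
  · have := hv 1
    rwa [map_one] at this

variable (W : StableOpen ρ)

instance finite_quotient : Finite (V ⧸ W.toAddSubgroup) :=
  AddSubgroup.quotient_finite_of_isOpen _ W.toOpenAddSubgroup.isOpen

/-- The open normal subgroup of those elements of `Q` which act trivially on `V ⧸ W`. -/
def kernel (hρ : Continuous fun z : Q × V => ρ z.1 z.2) : OpenNormalSubgroup Q where
  carrier := {q | ∀ v, ρ q v - v ∈ W.toAddSubgroup}
  mul_mem' {a b} ha hb v := by
    have := add_mem (ha (ρ b v)) (hb v)
    rwa [sub_add_sub_cancel, ← end_mul_apply] at this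
  one_mem' v := by simp
  inv_mem' {a} ha v := by
    have := neg_mem (ha (ρ a⁻¹ v))
    rwa [end_apply_inv_apply, neg_sub] at this
  isOpen' := by
    have hc : Continuous fun z : V × Q => ρ z.2 z.1 - z.1 :=
      (hρ.comp continuous_swap).sub continuous_fst
    exact isOpen_forall_of_compactSpace (W.toOpenAddSubgroup.isOpen.preimage hc)
  isNormal' := ⟨fun a ha g v => by
    have := W.stable g _ (ha (ρ g⁻¹ v))
    rwa [map_sub, end_apply_inv_apply, ← end_mul_apply,
      ← end_mul_apply] at this⟩

/-- The level `(ℤ/n)[Q/U]` acting on `V ⧸ W`: here `n` is the order of `V ⧸ W` and `U` the kernel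
of the action. -/
def level (hρ : Continuous fun z : Q × V => ρ z.1 z.2) : ℕ+ × OpenNormalSubgroup Q :=
  (⟨Nat.card (V ⧸ W.toAddSubgroup), Nat.card_pos⟩, W.kernel hρ)

/-- The action of `Q` on the quotient `V ⧸ W`. -/
def quotientAction : Q →* AddMonoid.End (V ⧸ W.toAddSubgroup) where
  toFun q := QuotientAddGroup.map _ _ (ρ q) (W.stable q)
  map_one' := by
    ext v
    obtain ⟨v, rfl⟩ := QuotientAddGroup.mk_surjective v
    change QuotientAddGroup.mk (ρ 1 v) = QuotientAddGroup.mk v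
    rw [map_one, AddMonoid.End.one_apply]
  map_mul' a b := by
    ext v
    obtain ⟨v, rfl⟩ := QuotientAddGroup.mk_surjective v
    exact congrArg QuotientAddGroup.mk (end_mul_apply ρ a b v)

omit [TopologicalSpace Q] [IsTopologicalAddGroup V] [CompactSpace V] in
lemma card_nsmul_eq_zero (x : V ⧸ W.toAddSubgroup) :
    Nat.card (V ⧸ W.toAddSubgroup) • x = 0 := card_nsmul_eq_zero'

/-- The ring homomorphism through which `Ẑ⟦Q⟧` acts on `V ⧸ W`. -/
def levelAction (hρ : Continuous fun z : Q × V => ρ z.1 z.2) :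
    Level Q (W.level hρ) →+* AddMonoid.End (V ⧸ W.toAddSubgroup) :=
  letI : Module (ZMod ((W.level hρ).1 : ℕ)) (V ⧸ W.toAddSubgroup) :=
    AddCommGroup.zmodModule W.card_nsmul_eq_zero
  MonoidAlgebra.liftNCRingHom (Module.toAddMonoidEnd (ZMod ((W.level hρ).1 : ℕ)) _)
    (QuotientGroup.lift _ W.quotientAction (by
      intro q hq
      ext v
      obtain ⟨v, rfl⟩ := QuotientAddGroup.mk_surjective v
      exact (QuotientAddGroup.eq_iff_sub_mem.2 (hq v))))
    (fun a g => by
      ext x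
      exact (ZMod.map_smul _ a _).symm)

lemma levelAction_single (hρ : Continuous fun z : Q × V => ρ z.1 z.2) (q : Q) (a : ℤ) (v : V) :
    W.levelAction hρ (MonoidAlgebra.single (QuotientGroup.mk q) a) (QuotientAddGroup.mk v) =
      QuotientAddGroup.mk (a • ρ q v) := by
  let _ : Module (ZMod ((W.level hρ).1 : ℕ)) (V ⧸ W.toAddSubgroup) :=
    AddCommGroup.zmodModule W.card_nsmul_eq_zero
  have h : W.levelAction hρ (MonoidAlgebra.single (QuotientGroup.mk q) a) =
    (Module.toAddMonoidEnd (ZMod ((W.level hρ).1 : ℕ)) _ a) * W.quotientAction q :=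
    MonoidAlgebra.liftNC_single _ _ _ _
  rw [h, map_intCast]
  rfl

lemma levelAction_of_le (hρ : Continuous fun z : Q × V => ρ z.1 z.2) {W W' : StableOpen ρ}
    (h : W.toAddSubgroup ≤ W'.toAddSubgroup) (r : completedGroupAlgebra Q) (v w : V)
    (hvw : W.levelAction hρ (proj _ r) v = w) : W'.levelAction hρ (proj _ r) v = w := by
  have hn : ((W'.level hρ).1 : ℕ) ∣ ((W.level hρ).1 : ℕ) := AddSubgroup.index_dvd_of_le h
  have hU : (W.level hρ).2.toSubgroup ≤ (W'.level hρ).2.toSubgroup := fun q hq v => h (hq v)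
  rw [← transition_proj hn hU]
  have key (x : Level Q (W.level hρ)) : W'.levelAction hρ (transition hn hU x) v =
      QuotientAddGroup.map W.toAddSubgroup W'.toAddSubgroup (AddMonoidHom.id V) h
        (W.levelAction hρ x v) := by
    induction x using MonoidAlgebra.induction_linear with
    | zero => simp
    | add x y hx hy =>
      rw [map_add, map_add, map_add, end_add_apply, end_add_apply, hx, hy]
      exact (map_add (QuotientAddGroup.map W.toAddSubgroup W'.toAddSubgroup (AddMonoidHom.id V) h)
        _ _).symm
    | single g a =>
      obtain ⟨g, rfl⟩ := QuotientGroup.mk_surjective g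
      obtain ⟨a, rfl⟩ := ZMod.intCast_surjective a
      rw [transition_single, map_intCast, levelAction_single, levelAction_single]
      rfl
  rw [key, hvw]
  rfl

end StableOpen

variable [IsTopologicalAddGroup V] [CompactSpace V] [T2Space V] [TotallyDisconnectedSpace V]
  [CompactSpace Q]

lemma eq_of_forall_stableOpen (hρ : Continuous fun z : Q × V => ρ z.1 z.2) {v w : V}
    (h : ∀ W : StableOpen ρ, (v : V ⧸ W.toAddSubgroup) = w) : v = w := by
  by_contra hne
  obtain ⟨W, hW⟩ := StableOpen.exists_subset hρ
    (isOpen_compl_singleton.mem_nhds (sub_ne_zero.2 hne).symm : {v - w}ᶜ ∈ 𝓝 (0 : V))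
  exact hW (QuotientAddGroup.eq_iff_sub_mem.1 (h W)) rfl

/-- The finite-level actions glue, by compactness of `V`. -/
lemma exists_smul (hρ : Continuous fun z : Q × V => ρ z.1 z.2) (r : completedGroupAlgebra Q)
    (v : V) : ∃ w : V, ∀ W : StableOpen ρ, W.levelAction hρ (proj _ r) v = w := by
  have hne (W : StableOpen ρ) : ∃ w : V, W.levelAction hρ (proj _ r) v = w :=
    ⟨_, (QuotientAddGroup.mk_surjective (W.levelAction hρ (proj _ r) v)).choose_spec.symm⟩
  have hcl (W : StableOpen ρ) : IsClosed {w : V | W.levelAction hρ (proj _ r) v = w} := by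
    obtain ⟨w₀, hw₀⟩ := hne W
    have : {w : V | W.levelAction hρ (proj _ r) v = w} =
        (fun w => w₀ - w) ⁻¹' (W.toAddSubgroup : Set V) := by
      ext w
      rw [Set.mem_ofPred_eq, hw₀, QuotientAddGroup.eq_iff_sub_mem]
      rfl
    rw [this]
    exact W.toOpenAddSubgroup.isClosed.preimage (continuous_const.sub continuous_id)
  have : Nonempty (StableOpen ρ) := ⟨(StableOpen.exists_subset hρ Filter.univ_mem).choose⟩
  obtain ⟨w, hw⟩ := IsCompact.nonempty_iInter_of_directed_nonempty_isCompact_isClosed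
    (fun W : StableOpen ρ => {w : V | W.levelAction hρ (proj _ r) v = w})
    (fun W W' => ⟨W.inf W',
      fun w hw => StableOpen.levelAction_of_le (W := W.inf W') hρ (fun _ h => And.left h)
        r v w hw,
      fun w hw => StableOpen.levelAction_of_le (W := W.inf W') hρ (fun _ h => And.right h)
        r v w hw⟩)
    hne (fun W => (hcl W).isCompact) hcl
  exact ⟨w, fun W => Set.mem_iInter.1 hw W⟩

/-- The scalar multiplication of `Ẑ⟦Q⟧` on a profinite `Q`-module `V`. -/
def smulAux (hρ : Continuous fun z : Q × V => ρ z.1 z.2) (r : completedGroupAlgebra Q) (v : V) :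
    V := (exists_smul hρ r v).choose

lemma mk_smulAux (hρ : Continuous fun z : Q × V => ρ z.1 z.2) (r : completedGroupAlgebra Q)
    (v : V) (W : StableOpen ρ) :
    ((smulAux hρ r v : V) : V ⧸ W.toAddSubgroup) = W.levelAction hρ (proj _ r) v :=
  ((exists_smul hρ r v).choose_spec W).symm

/-- The `Ẑ⟦Q⟧`-module structure on a profinite `Q`-module `V`. -/
@[reducible] def module (hρ : Continuous fun z : Q × V => ρ z.1 z.2) :
    Module (completedGroupAlgebra Q) V where
  smul := smulAux hρ
  one_smul v := eq_of_forall_stableOpen hρ fun W => by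
    refine (mk_smulAux hρ 1 v W).trans ?_
    rw [map_one, map_one, AddMonoid.End.one_apply]
  mul_smul r s v := eq_of_forall_stableOpen hρ fun W => by
    refine (mk_smulAux hρ (r * s) v W).trans (Eq.trans ?_ (mk_smulAux hρ r _ W).symm)
    rw [map_mul, map_mul]
    exact congrArg (W.levelAction hρ (proj _ r)) (mk_smulAux hρ s v W).symm
  smul_zero r := eq_of_forall_stableOpen hρ fun W =>
    (mk_smulAux hρ r 0 W).trans (map_zero _)
  smul_add r v w := eq_of_forall_stableOpen hρ fun W => by
    refine (mk_smulAux hρ r (v + w) W).trans ?_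
    rw [QuotientAddGroup.mk_add, map_add, ← mk_smulAux, ← mk_smulAux]
    rfl
  add_smul r s v := eq_of_forall_stableOpen hρ fun W => by
    refine (mk_smulAux hρ (r + s) v W).trans ?_
    rw [map_add, map_add, end_add_apply, ← mk_smulAux, ← mk_smulAux]
    rfl
  zero_smul v := eq_of_forall_stableOpen hρ fun W => by
    refine (mk_smulAux hρ 0 v W).trans ?_
    rw [map_zero, map_zero, AddMonoid.End.zero_apply]
    rfl

lemma smulAux_of (hρ : Continuous fun z : Q × V => ρ z.1 z.2) (q : Q) (v : V) :
    smulAux hρ (of q) v = ρ q v := eq_of_forall_stableOpen hρ fun W => by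
  rw [mk_smulAux, proj_of, ← Int.cast_one, StableOpen.levelAction_single, one_zsmul]

lemma continuous_smulAux (hρ : Continuous fun z : Q × V => ρ z.1 z.2) :
    Continuous fun z : completedGroupAlgebra Q × V => smulAux hρ z.1 z.2 := by
  rw [continuous_iff_continuousAt]
  rintro ⟨r, v⟩
  rw [ContinuousAt, ← tendsto_sub_nhds_zero_iff, Filter.tendsto_def]
  intro U hU
  obtain ⟨W, hW⟩ := StableOpen.exists_subset hρ hU
  have h1 : {s : completedGroupAlgebra Q | proj (W.level hρ) s ∈ ({proj _ r} : Set _)} ∈ 𝓝 r :=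
    (isOpen_proj_preimage _ _).mem_nhds rfl
  have h2 : {w : V | w - v ∈ W.toAddSubgroup} ∈ 𝓝 v :=
    (W.toOpenAddSubgroup.isOpen.preimage (continuous_id.sub continuous_const)).mem_nhds
      (by simp)
  refine Filter.mem_of_superset (prod_mem_nhds h1 h2) ?_
  rintro ⟨s, w⟩ ⟨hs, hw⟩
  refine hW (QuotientAddGroup.eq_iff_sub_mem.1 ?_)
  rw [mk_smulAux, mk_smulAux, QuotientAddGroup.eq_iff_sub_mem.2 hw]
  exact congrArg (fun x => W.levelAction hρ x v) hs

omit [IsTopologicalAddGroup V] [CompactSpace V] [TotallyDisconnectedSpace V] [CompactSpace Q] in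
lemma module_eq_of_continuous (i j : Module (completedGroupAlgebra Q) V)
    (hi : ∀ v, Continuous fun r => i.toSMul.smul r v)
    (hj : ∀ v, Continuous fun r => j.toSMul.smul r v)
    (h : ∀ q v, i.toSMul.smul (of q) v = j.toSMul.smul (of q) v) : i = j := by
  refine Module.ext ?_
  funext r v
  exact DFunLike.congr_fun (addMonoidHom_eq_of_continuous
    (f := ⟨⟨fun r => i.toSMul.smul r v, i.zero_smul v⟩, fun r s => i.add_smul r s v⟩)
    (g := ⟨⟨fun r => j.toSMul.smul r v, j.zero_smul v⟩, fun r s => j.add_smul r s v⟩)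
    (hi v) (hj v) (fun q => h q v)) r

end CompletedGroupAlgebra

/-! ### Commutators in two-generator metabelian groups -/

section Metabelian

variable {G : Type*} [Group G]

lemma map_mem_commutator {H : Type*} [Group H] (f : G →* H) {a : G} (ha : a ∈ commutator G) :
    f a ∈ commutator H := by
  have h := Subgroup.mem_map_of_mem f ha
  rw [commutator_def, Subgroup.map_commutator] at h
  exact Subgroup.commutator_mono le_top le_top h

lemma commutator_closure_pair_le {x y : G} {K : Subgroup G} [K.Normal] (h : ⁅x, y⁆ ∈ K)
    {a b : G} (ha : a ∈ Subgroup.closure {x, y}) (hb : b ∈ Subgroup.closure {x, y}) :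
    ⁅a, b⁆ ∈ K := by
  let π := QuotientGroup.mk' K
  have hxy : Commute (π x) (π y) := by
    rw [← commutatorElement_eq_one_iff_commute, ← map_commutatorElement]
    exact (QuotientGroup.eq_one_iff _).2 h
  have hcl : ∀ z : G, Commute (π x) (π z) → Commute (π y) (π z) →
      ∀ a ∈ Subgroup.closure {x, y}, Commute (π a) (π z) := by
    intro z hx hy a ha
    induction ha using Subgroup.closure_induction with
    | mem a ha => rcases ha with rfl | rfl <;> assumption
    | one => rw [map_one]; exact Commute.one_left _
    | mul a b _ _ ha hb => rw [map_mul]; exact ha.mul_left hb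
    | inv a _ ha => rw [map_inv]; exact ha.inv_left
  have hab : Commute (π a) (π b) :=
    hcl b (hcl x (Commute.refl _) hxy.symm b hb).symm (hcl y hxy (Commute.refl _) b hb).symm a ha
  rw [← commutatorElement_eq_one_iff_commute, ← map_commutatorElement] at hab
  exact (QuotientGroup.eq_one_iff _).1 hab

lemma commutatorElement_mul_of_commute {x m m' : G} (h : Commute m ⁅x, m'⁆) :
    ⁅x, m * m'⁆ = ⁅x, m⁆ * ⁅x, m'⁆ := by
  have : ⁅x, m * m'⁆ = ⁅x, m⁆ * (m * ⁅x, m'⁆ * m⁻¹) := by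
    simp only [commutatorElement_def]; group
  rw [this, h.eq, mul_inv_cancel_right]

/-- In a metabelian group, the products `[x, m][y, m']` with `m`, `m'` in the derived subgroup form
a subgroup: the image of the derived subgroup under the augmentation ideal. -/
def augmentationSubgroup (hG : ∀ a ∈ commutator G, ∀ b ∈ commutator G, a * b = b * a) (x y : G) :
    Subgroup G where
  carrier := {g | ∃ m ∈ commutator G, ∃ m' ∈ commutator G, g = ⁅x, m⁆ * ⁅y, m'⁆}
  one_mem' := ⟨1, one_mem _, 1, one_mem _, by simp⟩
  mul_mem' := by
    have hc (x m : G) : ⁅x, m⁆ ∈ commutator G :=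
      Subgroup.commutator_mem_commutator (Subgroup.mem_top _) (Subgroup.mem_top _)
    rintro _ _ ⟨m, hm, m', hm', rfl⟩ ⟨n, hn, n', hn', rfl⟩
    refine ⟨m * n, mul_mem hm hn, m' * n', mul_mem hm' hn', ?_⟩
    rw [commutatorElement_mul_of_commute (hG _ hm _ (hc _ _)),
      commutatorElement_mul_of_commute (hG _ hm' _ (hc _ _)), mul_assoc, mul_assoc,
      ← mul_assoc ⁅y, m'⁆, hG _ (hc y m') _ (hc x n), mul_assoc]
  inv_mem' := by
    have hc (x m : G) : ⁅x, m⁆ ∈ commutator G :=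
      Subgroup.commutator_mem_commutator (Subgroup.mem_top _) (Subgroup.mem_top _)
    have hi (x m : G) (hm : m ∈ commutator G) : ⁅x, m⁻¹⁆ = ⁅x, m⁆⁻¹ := by
      rw [eq_inv_iff_mul_eq_one, ← commutatorElement_mul_of_commute
        (hG _ (inv_mem hm) _ (hc _ _)), inv_mul_cancel, commutatorElement_one_right]
    rintro _ ⟨m, hm, m', hm', rfl⟩
    refine ⟨m⁻¹, inv_mem hm, m'⁻¹, inv_mem hm', ?_⟩
    rw [hi x m hm, hi y m' hm', mul_inv_rev, hG _ (inv_mem (hc y m')) _ (inv_mem (hc x m))]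

lemma augmentationSubgroup_normal
    (hG : ∀ a ∈ commutator G, ∀ b ∈ commutator G, a * b = b * a) (x y : G) :
    (augmentationSubgroup hG x y).Normal := by
  have hc (x m : G) : ⁅x, m⁆ ∈ commutator G :=
    Subgroup.commutator_mem_commutator (Subgroup.mem_top _) (Subgroup.mem_top _)
  have hn : (commutator G).Normal := inferInstance
  -- Conjugating `x` changes it by an element of the derived subgroup, which commutes with `m`.
  have key (g x m : G) (hm : m ∈ commutator G) : g * ⁅x, m⁆ * g⁻¹ = ⁅x, g * m * g⁻¹⁆ := by
    have h1 : g * ⁅x, m⁆ * g⁻¹ = ⁅g, x⁆ * (x * (g * m * g⁻¹) * x⁻¹) * ⁅g, x⁆⁻¹ *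
        (g * m * g⁻¹)⁻¹ := by
      simp only [commutatorElement_def]; group
    rw [h1, hG _ (hc g x) _ (hn.conj_mem _ (hn.conj_mem _ hm g) x), mul_inv_cancel_right,
      commutatorElement_def]
  refine ⟨?_⟩
  rintro _ ⟨m, hm, m', hm', rfl⟩ g
  refine ⟨_, hn.conj_mem _ hm g, _, hn.conj_mem _ hm' g, ?_⟩
  rw [← key g x m hm, ← key g y m' hm']
  group

/-- A two-generator metabelian group is of class two modulo `augmentationSubgroup`, and there its
derived subgroup is generated by `[x, y]`, whose powers are `[x, y ^ n]`. -/
lemma exists_eq_of_mem_commutator (hG : ∀ a ∈ commutator G, ∀ b ∈ commutator G, a * b = b * a)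
    {x y : G} (hxy : Subgroup.closure {x, y} = ⊤) {g : G} (hg : g ∈ commutator G) :
    ∃ u v w : G, g = ⁅x, u⁆ * ⁅x, v⁆ * ⁅y, w⁆ := by
  let K := augmentationSubgroup hG x y
  have hK : K.Normal := augmentationSubgroup_normal hG x y
  let π := QuotientGroup.mk' K
  have hc (x m : G) : ⁅x, m⁆ ∈ commutator G :=
    Subgroup.commutator_mem_commutator (Subgroup.mem_top _) (Subgroup.mem_top _)
  have hx (m : G) (hm : m ∈ commutator G) : Commute (π x) (π m) := by
    rw [← commutatorElement_eq_one_iff_commute, ← map_commutatorElement]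
    exact (QuotientGroup.eq_one_iff _).2 ⟨m, hm, 1, one_mem _, by simp⟩
  have hy (m : G) (hm : m ∈ commutator G) : Commute (π y) (π m) := by
    rw [← commutatorElement_eq_one_iff_commute, ← map_commutatorElement]
    exact (QuotientGroup.eq_one_iff _).2 ⟨1, one_mem _, m, hm, by simp⟩
  have hcent (a m : G) (hm : m ∈ commutator G) : Commute (π a) (π m) := by
    have ha : a ∈ Subgroup.closure {x, y} := hxy ▸ Subgroup.mem_top a
    induction ha using Subgroup.closure_induction with
    | mem a ha =>
      rcases ha with rfl | rfl
      exacts [hx m hm, hy m hm]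
    | one => rw [map_one]; exact Commute.one_left _
    | mul a b _ _ ha hb => rw [map_mul]; exact ha.mul_left hb
    | inv a _ ha => rw [map_inv]; exact ha.inv_left
  let L : Subgroup G := (Subgroup.zpowers (π ⁅x, y⁆)).comap π
  have hL : L.Normal := by
    refine ⟨fun a ha g => ?_⟩
    obtain ⟨n, hn⟩ := Subgroup.mem_zpowers_iff.1 (Subgroup.mem_comap.1 ha)
    have h1 : Commute (π g) (π a) := by
      rw [← hn]
      exact (hcent g _ (hc x y)).zpow_right n
    rw [Subgroup.mem_comap, map_mul, map_mul, h1.eq, map_inv, mul_inv_cancel_right]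
    exact ha
  have hgL : g ∈ L := by
    refine (commutator_def G ▸ Subgroup.commutator_le.2 fun a _ b _ => ?_ : commutator G ≤ L) hg
    exact commutator_closure_pair_le (Subgroup.mem_comap.2 (Subgroup.mem_zpowers _))
      (hxy ▸ Subgroup.mem_top a) (hxy ▸ Subgroup.mem_top b)
  obtain ⟨n, hn⟩ := Subgroup.mem_zpowers_iff.1 (Subgroup.mem_comap.1 hgL)
  have hpow (n : ℤ) : π ⁅x, y ^ n⁆ = π ⁅x, y⁆ ^ n := by
    have h1 : π x * π y * (π x)⁻¹ = π ⁅x, y⁆ * π y := by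
      rw [map_commutatorElement, commutatorElement_def, inv_mul_cancel_right]
    rw [map_commutatorElement, map_zpow, commutatorElement_def, ← conj_zpow, h1,
      (hy _ (hc x y)).symm.mul_zpow, mul_inv_cancel_right]
  have h2 : (⁅x, y ^ n⁆)⁻¹ * g ∈ K := by
    rw [← QuotientGroup.eq_one_iff]
    change π _ = 1
    rw [map_mul, map_inv, hpow, hn, inv_mul_cancel]
  obtain ⟨v, -, w, -, h3⟩ := h2
  exact ⟨y ^ n, v, w, by rw [mul_assoc, ← h3, mul_inv_cancel_left]⟩

variable [TopologicalSpace G] [IsTopologicalGroup G]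

/-- Commutators of a topological group lie in any closed subgroup which contains those of a dense
subgroup. -/
lemma commutator_subset_of_dense {Γ : Subgroup G} (hΓ : Γ.topologicalClosure = ⊤) {S : Set G}
    (hS : IsClosed S) (h : ∀ a ∈ Γ, ∀ b ∈ Γ, ⁅a, b⁆ ∈ S) (a b : G) : ⁅a, b⁆ ∈ S := by
  have hd : Dense ((Γ : Set G) ×ˢ (Γ : Set G)) := by
    have : Dense (Γ : Set G) := fun a => by
      rw [← Subgroup.topologicalClosure_coe, hΓ]; trivial
    exact this.prod this
  have hc : Continuous fun z : G × G => ⁅z.1, z.2⁆ := by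
    simp only [commutatorElement_def]; fun_prop
  have := (hS.preimage hc).closure_subset_iff.2
    (fun z (hz : z ∈ (Γ : Set G) ×ˢ (Γ : Set G)) => h z.1 hz.1 z.2 hz.2)
  exact this (hd (a, b))

/-- The derived subgroup of a two-generator profinite metabelian group is closed, because it is
the image of a compact set under a continuous map. -/
lemma isClosed_commutator [CompactSpace G] [T2Space G]
    (hG : ∀ a ∈ commutator G, ∀ b ∈ commutator G, a * b = b * a) {x y : G}
    (hxy : (Subgroup.closure {x, y}).topologicalClosure = ⊤) :
    IsClosed (commutator G : Set G) := by
  let f : G × G × G → G := fun z => ⁅x, z.1⁆ * ⁅x, z.2.1⁆ * ⁅y, z.2.2⁆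
  have hf : Continuous f := by
    simp only [f, commutatorElement_def]; fun_prop
  have hS : IsClosed (Set.range f) := (isCompact_range hf).isClosed
  have hc (x m : G) : ⁅x, m⁆ ∈ commutator G :=
    Subgroup.commutator_mem_commutator (Subgroup.mem_top _) (Subgroup.mem_top _)
  let Γ := Subgroup.closure {x, y}
  have hxΓ : x ∈ Γ := Subgroup.subset_closure (by simp)
  have hyΓ : y ∈ Γ := Subgroup.subset_closure (by simp)
  have hΓ' : ∀ a ∈ commutator Γ, (a : G) ∈ commutator G := fun a ha =>
    map_mem_commutator Γ.subtype ha
  have hΓ : ((commutator Γ).map Γ.subtype : Set G) ⊆ Set.range f := by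
    rintro _ ⟨a, ha, rfl⟩
    have hgen : Subgroup.closure {(⟨x, hxΓ⟩ : Γ), ⟨y, hyΓ⟩} = ⊤ := by
      have h1 := Subgroup.closure_closure_coe_preimage (k := ({x, y} : Set G))
      convert h1 using 2
      ext ⟨z, hz⟩
      simp
    obtain ⟨u, v, w, rfl⟩ := exists_eq_of_mem_commutator
      (fun a ha b hb => Subtype.ext (hG a (hΓ' a ha) b (hΓ' b hb))) hgen ha
    exact ⟨(u, v, w), rfl⟩
  have hcl : commutator G = ((commutator Γ).map Γ.subtype).topologicalClosure := by
    refine le_antisymm ?_ ?_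
    · rw [commutator_def]
      refine Subgroup.commutator_le.2 fun a _ b _ => ?_
      refine commutator_subset_of_dense hxy (Subgroup.isClosed_topologicalClosure _) ?_ a b
      intro a ha b hb
      refine Subgroup.le_topologicalClosure _ ⟨⁅(⟨a, ha⟩ : Γ), ⟨b, hb⟩⁆, ?_, rfl⟩
      exact Subgroup.commutator_mem_commutator (Subgroup.mem_top _) (Subgroup.mem_top _)
    · refine fun g hg => ?_
      obtain ⟨⟨u, v, w⟩, rfl⟩ := closure_minimal hΓ hS hg
      exact mul_mem (mul_mem (hc _ _) (hc _ _)) (hc _ _)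
  rw [hcl]
  exact Subgroup.isClosed_topologicalClosure _

end Metabelian

/-! ### Nonzero divisors in the completed group algebra -/

/-- A function on a finite group which is invariant under right translation by `z` has sum zero if
its values are killed by the order of `z`. -/
lemma sum_eq_zero_of_mul_right_invariant {X A : Type*} [Group X] [Fintype X] [AddCommGroup A]
    (z : X) (F : X → A) (hF : ∀ g, F (g * z) = F g) (hA : ∀ a : A, orderOf z • a = 0) :
    ∑ g, F g = 0 := by
  classical
  have hpow (n : ℕ) (g : X) : F (g * z ^ n) = F g := by
    induction n with
    | zero => simp
    | succ n ih => rw [pow_succ, ← mul_assoc, hF, ih]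
  let H := Subgroup.zpowers z
  let e : X ≃ (X ⧸ H) × H := Subgroup.groupEquivQuotientProdSubgroup
  have he (g : X) : F g = F (e g).1.out := by
    have h1 : (e g).1 = QuotientGroup.mk g := rfl
    obtain ⟨⟨h, hh⟩, h2⟩ := QuotientGroup.mk_out_eq_mul H g
    obtain ⟨n, rfl⟩ := mem_powers_iff_mem_zpowers.2 hh
    rw [h1, h2]
    exact (hpow n g).symm
  calc ∑ g, F g = ∑ g, F (e g).1.out := Finset.sum_congr rfl fun g _ => he g
    _ = ∑ w : (X ⧸ H) × H, F w.1.out := e.sum_comp fun w => F w.1.out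
    _ = 0 := by
      rw [Fintype.sum_prod_type]
      refine Finset.sum_eq_zero fun q _ => ?_
      change ∑ _ : H, F q.out = 0
      rw [Finset.sum_const, Finset.card_univ, ← Nat.card_eq_fintype_card, Nat.card_zpowers, hA]

namespace CompletedGroupAlgebra

variable {Q : Type*} [Group Q] [TopologicalSpace Q] [IsTopologicalGroup Q] [CompactSpace Q]

/-- If `y` maps to a generator of a continuous quotient `ℤ/N` for every `N`, then `y - 1` is a
nonzero divisor of `Ẑ⟦Q⟧`. Indeed let `r y = r` and let `k` be the order of `y` modulo `U`. Modulo
a small enough `V ≤ U` the order of `y ^ k` is divisible by `n`, and the coefficients of `r` are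
constant on the cosets of `⟨y ^ k⟩`, so that their sums over the fibres of `Q/V → Q/U` vanish in
`ℤ/n`. -/
lemma eq_zero_of_mul_of_eq {y : Q}
    (hy : ∀ N : ℕ+, ∃ χ : Q →* Multiplicative (ZMod N), IsOpen (χ.ker : Set Q) ∧
      χ y = Multiplicative.ofAdd 1)
    {r : completedGroupAlgebra Q} (hr : r * of y = r) : r = 0 := by
  refine ext_proj fun p => ?_
  obtain ⟨n, U⟩ := p
  have : Finite (Q ⧸ U.toSubgroup) :=
    Subgroup.quotient_finite_of_isOpen _ U.toOpenSubgroup.isOpen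
  let k := orderOf (QuotientGroup.mk y : Q ⧸ U.toSubgroup)
  have hk : 0 < k := orderOf_pos _
  obtain ⟨χ, hχ, hχy⟩ := hy (⟨k, hk⟩ * n)
  let V : OpenNormalSubgroup Q :=
    U ⊓ { toSubgroup := χ.ker, isOpen' := hχ, isNormal' := inferInstance }
  have : Finite (Q ⧸ V.toSubgroup) :=
    Subgroup.quotient_finite_of_isOpen _ V.toOpenSubgroup.isOpen
  have := Fintype.ofFinite (Q ⧸ V.toSubgroup)
  have hVU : V.toSubgroup ≤ U.toSubgroup := fun _ h => And.left h
  have hVχ : V.toSubgroup ≤ χ.ker := fun _ h => And.right h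
  have hyk : y ^ k ∈ U.toSubgroup := by
    rw [← QuotientGroup.eq_one_iff, QuotientGroup.mk_pow]
    exact pow_orderOf_eq_one _
  let z : Q ⧸ V.toSubgroup := QuotientGroup.mk (y ^ k)
  have hz : (n : ℕ) ∣ orderOf z := by
    have h1 : z ^ orderOf z = 1 := pow_orderOf_eq_one z
    rw [← QuotientGroup.mk_pow, QuotientGroup.eq_one_iff, ← pow_mul] at h1
    have h2 := hVχ h1
    rw [MonoidHom.mem_ker, map_pow, hχy, ← ofAdd_nsmul, nsmul_one, ofAdd_eq_one,
      ZMod.natCast_eq_zero_iff] at h2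
    have h2 : k * n ∣ k * orderOf z := h2
    exact Nat.dvd_of_mul_dvd_mul_left hk h2
  let x := proj (n, V) r
  have hx : x * MonoidAlgebra.single z 1 = x := by
    have h1 (i : ℕ) : r * of (y ^ i) = r := by
      induction i with
      | zero => simp
      | succ i ih => rw [pow_succ, map_mul, ← mul_assoc, ih, hr]
    have h2 := congrArg (proj (n, V)) (h1 k)
    rwa [map_mul, proj_of] at h2
  have hcoeff (g : Q ⧸ V.toSubgroup) : x.coeff (g * z) = x.coeff g := by
    conv_lhs => rw [← hx]
    rw [MonoidAlgebra.coeff_mul_single_eq_coeff_mul g fun m _ => mul_left_inj z, mul_one]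
  have hsum : x = ∑ g, MonoidAlgebra.single g (x.coeff g) := by
    conv_lhs => rw [← MonoidAlgebra.sum_coeff_single x]
    exact Finsupp.sum_fintype _ _ fun _ => MonoidAlgebra.single_zero _
  have hn : ((n, U) : ℕ+ × OpenNormalSubgroup Q).1.val ∣
    ((n, V) : ℕ+ × OpenNormalSubgroup Q).1.val := dvd_rfl
  rw [← transition_proj (p := (n, U)) (q := (n, V)) hn hVU, map_zero]
  change transition (p := (n, U)) (q := (n, V)) hn hVU x = 0
  rw [hsum, map_sum]
  refine sum_eq_zero_of_mul_right_invariant z _ (fun g => ?_) (fun a => ?_)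
  · rw [hcoeff]
    obtain ⟨g, rfl⟩ := QuotientGroup.mk_surjective g
    have h1 : (QuotientGroup.mk (g * y ^ k) : Q ⧸ U.toSubgroup) = QuotientGroup.mk g :=
      QuotientGroup.mk_mul_of_mem g hyk
    rw [← QuotientGroup.mk_mul, transition_single, transition_single]
    exact congrArg (fun w => MonoidAlgebra.single w _) h1
  · obtain ⟨m, hm⟩ := hz
    have h1 : ((orderOf z : ℕ) : Level Q (n, U)) = 0 := by
      rw [hm, Nat.cast_mul]
      have : ((n : ℕ) : Level Q (n, U)) = 0 := by
        rw [← map_natCast (algebraMap (ZMod n) (Level Q (n, U))), ZMod.natCast_self, map_zero]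
      rw [this, zero_mul]
    rw [nsmul_eq_mul, h1, zero_mul]

end CompletedGroupAlgebra

/-! ### Generators and finite quotients of the free profinite metabelian group -/

namespace MHat

open ProfiniteGrp.ProfiniteCompletion

/-- The canonical homomorphism from the free group to `M̂`. -/
def ofFree : FreeGroup (Fin 2) →* MHat :=
  (eta (GrpCat.of FreeMetabelian)).hom.comp
    (QuotientGroup.mk' (derivedSeries (FreeGroup (Fin 2)) 2))

/-- The standard topological generators of `M̂`. -/
def gen (i : Fin 2) : MHat := ofFree (FreeGroup.of i)

lemma denseRange_ofFree : DenseRange ofFree := by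
  have h : Set.range ofFree = Set.range (etaFn (GrpCat.of FreeMetabelian)) :=
    (QuotientGroup.mk'_surjective (derivedSeries (FreeGroup (Fin 2)) 2)).range_comp
      (etaFn (GrpCat.of FreeMetabelian))
  rw [DenseRange, h]
  exact denseRange _

lemma generates_gen : GeneratesMHat (gen 0) (gen 1) := by
  have h : Subgroup.closure ({gen 0, gen 1} : Set MHat) = ofFree.range := by
    rw [MonoidHom.range_eq_map, ← FreeGroup.closure_range_of, MonoidHom.map_closure]
    congr 1
    ext x
    simp [gen, Fin.exists_fin_two, eq_comm]
  rw [GeneratesMHat, h]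
  refine SetLike.coe_injective ?_
  rw [Subgroup.topologicalClosure_coe, MonoidHom.coe_range, denseRange_ofFree.closure_range]
  rfl

/-- The universal property of `M̂` for finite metabelian groups: the generators may be mapped to
arbitrary elements. -/
lemma exists_hom {E : Type*} [Group E] [Finite E] [TopologicalSpace E] [DiscreteTopology E]
    (hE : derivedSeries E 2 = ⊥) (e : Fin 2 → E) :
    ∃ f : MHat →* E, Continuous f ∧ ∀ i, f (gen i) = e i := by
  let f₀ : FreeMetabelian →* E := QuotientGroup.lift _ (FreeGroup.lift e) (by
    rw [← Subgroup.map_eq_bot_iff, eq_bot_iff, ← hE]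
    exact map_derivedSeries_le_derivedSeries _ 2)
  have hfin : f₀.ker.FiniteIndex := inferInstance
  let H : FiniteIndexNormalSubgroup (GrpCat.of FreeMetabelian) :=
    { toSubgroup := f₀.ker, isNormal' := inferInstance, isFiniteIndex' := hfin }
  let π : MHat →* (FreeMetabelian ⧸ f₀.ker) :=
    { toFun := fun y => y.1 H, map_one' := rfl, map_mul' := fun _ _ => rfl }
  refine ⟨(QuotientGroup.kerLift f₀).comp π, ?_, fun i => ?_⟩
  · have h1 : Continuous fun y : MHat => y.1 H :=
      (continuous_apply H).comp continuous_subtype_val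
    have h2 : DiscreteTopology ((diagram (GrpCat.of FreeMetabelian)).obj H) := ⟨rfl⟩
    let k : (diagram (GrpCat.of FreeMetabelian)).obj H → E := QuotientGroup.kerLift f₀
    exact (continuous_of_discreteTopology (f := k)).comp h1
  · change FreeGroup.lift e (FreeGroup.of i) = e i
    exact FreeGroup.lift_apply_of

lemma eq_of_continuous {E : Type*} [Group E] [TopologicalSpace E] [T2Space E]
    {f g : MHat →* E} (hf : Continuous f) (hg : Continuous g) (h : ∀ i, f (gen i) = g (gen i)) :
    f = g := by
  have h1 : f.comp ofFree = g.comp ofFree := FreeGroup.ext_hom _ _ h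
  exact DFunLike.coe_injective (denseRange_ofFree.equalizer hf hg (congrArg DFunLike.coe h1))

lemma comm_of_mem_commutator : ∀ a ∈ commutator MHat, ∀ b ∈ commutator MHat, a * b = b * a :=
  fun a ha b hb => congrArg Subtype.val (mul_comm (⟨a, ha⟩ : MHatDerived) ⟨b, hb⟩)

lemma isClosed_derived : IsClosed (MHatDerived : Set MHat) :=
  isClosed_commutator comm_of_mem_commutator generates_gen

lemma topologicalClosure_commutator : (commutator MHat).topologicalClosure = commutator MHat :=
  SetLike.coe_injective isClosed_derived.closure_eq

/-- The conjugation action of `M̂` on `M̂'`. -/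
def conjHom : MHat →* AddMonoid.End (Additive MHatDerived) where
  toFun g :=
    { toFun := fun m => Additive.ofMul (conjDerived g m.toMul)
      map_zero' := by
        refine congrArg Additive.ofMul (Subtype.ext ?_)
        change g * 1 * g⁻¹ = 1
        group
      map_add' := fun m m' => by
        refine congrArg Additive.ofMul (Subtype.ext ?_)
        change g * (m.toMul.1 * m'.toMul.1) * g⁻¹ = g * m.toMul.1 * g⁻¹ * (g * m'.toMul.1 * g⁻¹)
        group }
  map_one' := by
    refine AddMonoidHom.ext fun m => ?_
    refine congrArg Additive.ofMul (Subtype.ext ?_)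
    change 1 * m.toMul.1 * 1⁻¹ = m.toMul.1
    group
  map_mul' a b := by
    refine AddMonoidHom.ext fun m => ?_
    refine congrArg Additive.ofMul (Subtype.ext ?_)
    change a * b * m.toMul.1 * (a * b)⁻¹ = a * (b * m.toMul.1 * b⁻¹) * a⁻¹
    group

/-- The action of `Â` on `M̂'` induced by conjugation. -/
def action : AHat →* AddMonoid.End (Additive MHatDerived) :=
  QuotientGroup.lift _ conjHom fun g hg => by
    rw [topologicalClosure_commutator] at hg
    refine AddMonoidHom.ext fun m => ?_
    refine congrArg Additive.ofMul (Subtype.ext ?_)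
    change g * m.toMul.1 * g⁻¹ = m.toMul.1
    rw [comm_of_mem_commutator g hg m.toMul.1 m.toMul.2, mul_inv_cancel_right]

lemma action_mk (g : MHat) (m : MHatDerived) :
    action (QuotientGroup.mk g) (Additive.ofMul m) = Additive.ofMul (conjDerived g m) := rfl

lemma continuous_action :
    Continuous fun z : AHat × Additive MHatDerived => action z.1 z.2 := by
  have hq : IsOpenQuotientMap (Prod.map (QuotientGroup.mk : MHat → AHat)
      (id : Additive MHatDerived → Additive MHatDerived)) :=
    (QuotientGroup.isOpenQuotientMap_mk).prodMap IsOpenQuotientMap.id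
  rw [hq.isQuotientMap.continuous_iff]
  have : Continuous fun z : MHat × MHatDerived => conjDerived z.1 z.2 := by
    refine Continuous.subtype_mk ?_ _
    fun_prop
  exact this

instance : CompactSpace MHatDerived := isCompact_iff_compactSpace.1 isClosed_derived.isCompact

instance : TotallyDisconnectedSpace (Additive MHatDerived) :=
  inferInstanceAs (TotallyDisconnectedSpace MHatDerived)

/-- The `Ẑ⟦Â⟧`-module structure on `M̂'`. -/
@[reducible] def derivedModule : Module (completedGroupAlgebra AHat) (Additive MHatDerived) :=
  CompletedGroupAlgebra.module continuous_action

lemma extendsConjugation_derivedModule : ExtendsConjugation derivedModule :=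
  ⟨CompletedGroupAlgebra.continuous_smulAux continuous_action, fun _ _ =>
    CompletedGroupAlgebra.smulAux_of continuous_action _ _⟩

lemma _root_.ExtendsConjugation.continuous_smul_left
    {inst : Module (completedGroupAlgebra AHat) (Additive MHatDerived)}
    (h : ExtendsConjugation inst) (m : Additive MHatDerived) :
    Continuous fun r => inst.toSMul.smul r m :=
  h.1.comp (Continuous.prodMk_left m)

/-- Uniqueness of the module structure. -/
lemma eq_of_extendsConjugation
    {i j : Module (completedGroupAlgebra AHat) (Additive MHatDerived)}
    (hi : ExtendsConjugation i) (hj : ExtendsConjugation j) : i = j := by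
  refine CompletedGroupAlgebra.module_eq_of_continuous i j hi.continuous_smul_left
    hj.continuous_smul_left fun q v => ?_
  obtain ⟨g, rfl⟩ := QuotientGroup.mk_surjective q
  exact (hi.2 g v.toMul).trans (hj.2 g v.toMul).symm

end MHat

/-! ### Freeness of the derived subgroup -/

lemma commutator_eq_bot_of_comm {X : Type*} [Group X] (hX : ∀ a b : X, a * b = b * a) :
    commutator X = ⊥ := by
  rw [commutator_def, eq_bot_iff]
  refine Subgroup.commutator_le.2 fun a _ b _ => ?_
  rw [Subgroup.mem_bot, commutatorElement_eq_one_iff_mul_comm, hX]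

section RingSemidirect

variable {R X : Type*} [Ring R] [Group X]

/-- The action of a group `X` on the additive group of a ring `R` by left multiplication, through
a homomorphism `u` to the multiplicative monoid of `R`. -/
def mulLeftAut (u : X →* R) : X →* MulAut (Multiplicative R) where
  toFun g :=
    { toFun := fun r => Multiplicative.ofAdd (u g * r.toAdd)
      invFun := fun r => Multiplicative.ofAdd (u g⁻¹ * r.toAdd)
      left_inv := fun r => by
        simp [← mul_assoc, ← map_mul]
      right_inv := fun r => by
        simp [← mul_assoc, ← map_mul]
      map_mul' := fun r s => by
        rw [toAdd_mul, mul_add, ofAdd_add] }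
  map_one' := by
    ext r
    simp
  map_mul' a b := by
    ext r
    simp [mul_assoc]

lemma mulLeftAut_apply (u : X →* R) (g : X) (r : Multiplicative R) :
    mulLeftAut u g r = Multiplicative.ofAdd (u g * r.toAdd) := rfl

lemma right_eq_one_of_mem_commutator (hX : ∀ a b : X, a * b = b * a)
    (φ : X →* MulAut (Multiplicative R)) {a : Multiplicative R ⋊[φ] X}
    (ha : a ∈ commutator (Multiplicative R ⋊[φ] X)) :
    a.right = 1 := by
  have h := map_mem_commutator SemidirectProduct.rightHom ha
  rwa [commutator_eq_bot_of_comm hX, Subgroup.mem_bot] at h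

lemma derivedSeries_semidirectProduct (hX : ∀ a b : X, a * b = b * a)
    (φ : X →* MulAut (Multiplicative R)) : derivedSeries (Multiplicative R ⋊[φ] X) 2 = ⊥ := by
  rw [derivedSeries_succ, derivedSeries_one, eq_bot_iff]
  refine Subgroup.commutator_le.2 fun a ha b hb => ?_
  rw [Subgroup.mem_bot, commutatorElement_eq_one_iff_mul_comm]
  have ha := right_eq_one_of_mem_commutator hX φ ha
  have hb := right_eq_one_of_mem_commutator hX φ hb
  ext
  · simp [ha, hb, mul_comm]
  · simp [ha, hb]

lemma conj_left (u : X →* R) (a b : Multiplicative R ⋊[mulLeftAut u] X) (hb : b.right = 1) :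
    (a * b * a⁻¹).left = Multiplicative.ofAdd (u a.right * b.left.toAdd) := by
  rw [SemidirectProduct.mul_left, SemidirectProduct.mul_left, SemidirectProduct.inv_left,
    SemidirectProduct.mul_right, hb, mul_one, ← MulAut.mul_apply, ← map_mul, mul_inv_cancel,
    map_one, MulAut.one_apply, mul_comm a.left, mul_inv_cancel_right]
  rfl

lemma commutatorElement_left (u : X →* R) {g h : X} (hgh : g * h = h * g) :
    (⁅(⟨Multiplicative.ofAdd 1, g⟩ : Multiplicative R ⋊[mulLeftAut u] X),
        (⟨1, h⟩ : Multiplicative R ⋊[mulLeftAut u] X)⁆).left =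
      Multiplicative.ofAdd (1 - u h) := by
  rw [commutatorElement_def]
  simp only [SemidirectProduct.mul_left, SemidirectProduct.inv_left,
    SemidirectProduct.mul_right, map_one, inv_one, mul_one]
  rw [← MulAut.mul_apply, ← map_mul, hgh, mul_inv_cancel_right, mulLeftAut_apply, ← ofAdd_add,
    toAdd_inv, toAdd_ofAdd, mul_neg, mul_one, sub_eq_add_neg]

end RingSemidirect

namespace MHat

open CompletedGroupAlgebra

attribute [local instance] derivedModule

lemma smul_of (g : MHat) (m : Additive MHatDerived) :
    of (QuotientGroup.mk g : AHat) • m = Additive.ofMul (conjDerived g m.toMul) :=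
  extendsConjugation_derivedModule.2 g m.toMul

lemma continuous_smul_left (m : Additive MHatDerived) :
    Continuous fun r : completedGroupAlgebra AHat => r • m :=
  extendsConjugation_derivedModule.continuous_smul_left m

lemma mul_comm_AHat (a b : AHat) : a * b = b * a := mul_comm a b

/-- The submodule generated by `[x, y]` is compact, hence it is closed; it contains all commutators
of the dense subgroup generated by `x` and `y`. -/
lemma exists_smul_commDerived_eq {x y : MHat} (h : GeneratesMHat x y) (m : Additive MHatDerived) :
    ∃ r : completedGroupAlgebra AHat, r • Additive.ofMul (commDerived x y) = m := by
  let c : Additive MHatDerived := Additive.ofMul (commDerived x y)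
  let K₀ : Subgroup MHatDerived :=
    AddSubgroup.toSubgroup' (LinearMap.range (LinearMap.toSpanSingleton
      (completedGroupAlgebra AHat) (Additive MHatDerived) c)).toAddSubgroup
  let K : Subgroup MHat := K₀.map MHatDerived.subtype
  have hmem (r : completedGroupAlgebra AHat) : ((r • c).toMul : MHat) ∈ K :=
    ⟨(r • c).toMul, ⟨r, rfl⟩, rfl⟩
  have hclosed : IsClosed (K : Set MHat) := by
    have h1 : (K : Set MHat) = Set.range fun r : completedGroupAlgebra AHat =>
        ((r • c).toMul : MHat) := by
      ext g
      constructor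
      · rintro ⟨_, ⟨r, rfl⟩, rfl⟩
        exact ⟨r, rfl⟩
      · rintro ⟨r, rfl⟩
        exact hmem r
    rw [h1]
    exact (isCompact_range (continuous_subtype_val.comp
      (continuous_toMul.comp (continuous_smul_left c)))).isClosed
  have hnormal : K.Normal := by
    refine ⟨?_⟩
    rintro _ ⟨_, ⟨r, rfl⟩, rfl⟩ g
    have h1 := hmem (of (QuotientGroup.mk g : AHat) * r)
    rw [mul_smul, smul_of] at h1
    exact h1
  have hxy : ⁅x, y⁆ ∈ K := by
    have h1 := hmem 1
    rwa [one_smul] at h1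
  have hle : commutator MHat ≤ K := by
    rw [commutator_def]
    refine Subgroup.commutator_le.2 fun a _ b _ => ?_
    exact commutator_subset_of_dense h hclosed
      (fun a ha b hb => commutator_closure_pair_le hxy ha hb) a b
  obtain ⟨_, ⟨r, rfl⟩, hr⟩ := hle m.toMul.2
  exact ⟨r, Subtype.ext hr⟩

/-- Since `M̂` is free, it maps to the finite metabelian group `R ⋊ Â/U`, where `R = (ℤ/n)[Â/U]`,
so that the generators go to `(1, x)` and `(0, y)`. Their commutator is `(1 - y, 1)`, and the map on
derived subgroups is compatible with the projection `Ẑ⟦Â⟧ → R`. -/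
lemma proj_mul_of_smul_eq_zero {r : completedGroupAlgebra AHat}
    (hr : r • Additive.ofMul (commDerived (gen 0) (gen 1)) = 0)
    (p : ℕ+ × OpenNormalSubgroup AHat) :
    proj p r * (1 - proj p (of (QuotientGroup.mk (gen 1)))) = 0 := by
  let X := AHat ⧸ p.2.toSubgroup
  let R := Level AHat p
  have hX : ∀ a b : X, a * b = b * a := by
    rintro ⟨a⟩ ⟨b⟩
    exact congrArg QuotientGroup.mk (mul_comm_AHat a b)
  let u : X →* R := MonoidAlgebra.of _ _
  let E := Multiplicative R ⋊[mulLeftAut u] X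
  have : Finite X := Subgroup.quotient_finite_of_isOpen _ p.2.toOpenSubgroup.isOpen
  have : Finite (Multiplicative R) := finite_level p
  have : Finite E := Finite.of_equiv _ SemidirectProduct.equivProd.symm
  let _ : TopologicalSpace E := ⊥
  have : DiscreteTopology E := ⟨rfl⟩
  let _ : TopologicalSpace R := ⊥
  have : DiscreteTopology R := ⟨rfl⟩
  let q : MHat →* X := (QuotientGroup.mk' p.2.toSubgroup).comp
    (QuotientGroup.mk' (commutator MHat).topologicalClosure)
  obtain ⟨f, hf, hfgen⟩ := exists_hom (E := E) (derivedSeries_semidirectProduct hX (mulLeftAut u))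
    ![⟨Multiplicative.ofAdd 1, q (gen 0)⟩, ⟨1, q (gen 1)⟩]
  have hf0 := hfgen 0
  have hf1 := hfgen 1
  have : DiscreteTopology X := QuotientGroup.discreteTopology p.2.toOpenSubgroup.isOpen
  have hright (g : MHat) : (f g).right = q g := by
    have h1 : (SemidirectProduct.rightHom (φ := mulLeftAut u)).comp f = q := by
      refine eq_of_continuous
        ((continuous_of_discreteTopology (f := fun e : E => e.right)).comp hf)
        (QuotientGroup.continuous_mk.comp QuotientGroup.continuous_mk) fun i => ?_
      fin_cases i
      · exact congrArg SemidirectProduct.right hf0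
      · exact congrArg SemidirectProduct.right hf1
    exact DFunLike.congr_fun h1 g
  have hD (m : MHatDerived) : (f m).right = 1 :=
    right_eq_one_of_mem_commutator hX _ (map_mem_commutator f m.2)
  let δ : Additive MHatDerived →+ R :=
    { toFun := fun m => (f m.toMul).left.toAdd
      map_zero' := by
        change (f 1).left.toAdd = 0
        rw [map_one]; rfl
      map_add' := fun m m' => by
        change (f (m.toMul * m'.toMul)).left.toAdd = _
        rw [map_mul, SemidirectProduct.mul_left, hD, map_one, toAdd_mul]
        rfl }
  have hδ : Continuous δ := by
    have h1 : Continuous fun e : E => e.left.toAdd := continuous_of_discreteTopology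
    exact h1.comp (hf.comp (continuous_subtype_val.comp continuous_toMul))
  have hδsmul (s : completedGroupAlgebra AHat) (m : Additive MHatDerived) :
      δ (s • m) = proj p s * δ m := by
    let f₁ : completedGroupAlgebra AHat →+ R :=
      δ.comp ((LinearMap.toSpanSingleton (completedGroupAlgebra AHat) _ m).toAddMonoidHom)
    let f₂ : completedGroupAlgebra AHat →+ R :=
      (AddMonoidHom.mulRight (δ m)).comp (proj p).toAddMonoidHom
    have h1 : Continuous f₁ := hδ.comp (continuous_smul_left m)
    have h2 : Continuous f₂ := ⟨fun t _ => isOpen_proj_preimage p ((· * δ m) ⁻¹' t)⟩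
    refine DFunLike.congr_fun (addMonoidHom_eq_of_continuous h1 h2 fun a => ?_) s
    obtain ⟨g, rfl⟩ := QuotientGroup.mk_surjective a
    change δ (of (QuotientGroup.mk g : AHat) • m) = proj p (of (QuotientGroup.mk g)) * δ m
    rw [smul_of]
    change (f (g * m.toMul * g⁻¹)).left.toAdd = u (q g) * (f m.toMul).left.toAdd
    rw [map_mul, map_mul, map_inv, conj_left u _ _ (hD _), hright]
    rfl
  have hδc : δ (Additive.ofMul (commDerived (gen 0) (gen 1))) =
      1 - proj p (of (QuotientGroup.mk (gen 1))) := by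
    change (f ⁅gen 0, gen 1⁆).left.toAdd = 1 - u (q (gen 1))
    rw [map_commutatorElement, hf0, hf1]
    exact congrArg Multiplicative.toAdd (commutatorElement_left u (hX _ _))
  rw [← hδc, ← hδsmul, hr, map_zero]

/-- Killing `x` and reducing modulo `N` gives continuous characters of `Â` which map `y` to a
generator of `ℤ/N`. -/
lemma exists_character (N : ℕ+) : ∃ χ : AHat →* Multiplicative (ZMod N),
    IsOpen (χ.ker : Set AHat) ∧ χ (QuotientGroup.mk (gen 1)) = Multiplicative.ofAdd 1 := by
  let _ : TopologicalSpace (Multiplicative (ZMod N)) := ⊥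
  have : DiscreteTopology (Multiplicative (ZMod N)) := ⟨rfl⟩
  have hcomm : commutator (Multiplicative (ZMod N)) = ⊥ := commutator_eq_bot_of_comm mul_comm
  obtain ⟨f, hf, hfgen⟩ := exists_hom (E := Multiplicative (ZMod N))
    (by rw [derivedSeries_succ, derivedSeries_one, hcomm, Subgroup.commutator_bot_left])
    ![1, Multiplicative.ofAdd 1]
  have hker : (commutator MHat).topologicalClosure ≤ f.ker := by
    intro g hg
    rw [topologicalClosure_commutator] at hg
    have h1 := map_mem_commutator f hg
    rwa [hcomm, Subgroup.mem_bot] at h1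
  have hcont : Continuous (QuotientGroup.lift (commutator MHat).topologicalClosure f hker) :=
    QuotientGroup.isOpenQuotientMap_mk.isQuotientMap.continuous_iff.2 hf
  exact ⟨QuotientGroup.lift _ f hker, (isOpen_discrete {1}).preimage hcont, hfgen 1⟩

/-- The annihilator of `[x, y]` is trivial for the standard generators `x`, `y`. -/
lemma eq_zero_of_smul_eq_zero {r : completedGroupAlgebra AHat}
    (hr : r • Additive.ofMul (commDerived (gen 0) (gen 1)) = 0) : r = 0 := by
  refine eq_zero_of_mul_of_eq exists_character (ext_proj fun p => ?_)
  have h := proj_mul_of_smul_eq_zero hr p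
  rw [mul_sub, mul_one, sub_eq_zero] at h
  rw [map_mul, ← h]

/-- The commutators of two pairs of generators differ by a unit of `Ẑ⟦Â⟧`, so it suffices to
know the annihilator of one of them. -/
lemma exists_basis {x y : MHat} (h : GeneratesMHat x y) :
    ∃ b : Module.Basis (Fin 1) (completedGroupAlgebra AHat) (Additive MHatDerived),
      b 0 = Additive.ofMul (commDerived x y) := by
  let c := Additive.ofMul (commDerived x y)
  let c₀ := Additive.ofMul (commDerived (gen 0) (gen 1))
  obtain ⟨u, hu : u • c₀ = c⟩ := exists_smul_commDerived_eq generates_gen c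
  obtain ⟨v, hv : v • c = c₀⟩ := exists_smul_commDerived_eq h c₀
  have hvu : u * v = 1 := by
    rw [mul_comm_of_comm mul_comm_AHat, ← sub_eq_zero]
    refine eq_zero_of_smul_eq_zero ?_
    rw [sub_smul, mul_smul, one_smul, hu, hv, sub_self]
  have hbij : Function.Bijective
      (LinearMap.toSpanSingleton (completedGroupAlgebra AHat) (Additive MHatDerived) c) := by
    refine ⟨?_, exists_smul_commDerived_eq h⟩
    rw [injective_iff_map_eq_zero]
    intro r hr
    rw [LinearMap.toSpanSingleton_apply, ← hu, ← mul_smul] at hr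
    rw [← mul_one r, ← hvu, ← mul_assoc, eq_zero_of_smul_eq_zero hr, zero_mul]
  refine ⟨(Module.Basis.singleton (Fin 1) _).map (LinearEquiv.ofBijective _ hbij), ?_⟩
  rw [Module.Basis.map_apply, Module.Basis.singleton_apply, LinearEquiv.ofBijective_apply,
    LinearMap.toSpanSingleton_apply, one_smul]

end MHat

theorem mainTheorem8 :
    IsClosed (MHatDerived : Set MHat) ∧
    ∃ inst : Module (completedGroupAlgebra AHat) (Additive MHatDerived),
      ExtendsConjugation inst ∧
      (∀ inst' : Module (completedGroupAlgebra AHat) (Additive MHatDerived),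
        ExtendsConjugation inst' → inst' = inst) ∧
      ∀ x₁ x₂ : MHat, GeneratesMHat x₁ x₂ →
        ∃ b : Module.Basis (Fin 1) (completedGroupAlgebra AHat) (Additive MHatDerived),
          b 0 = Additive.ofMul (commDerived x₁ x₂) :=
  ⟨MHat.isClosed_derived, MHat.derivedModule, MHat.extendsConjugation_derivedModule,
    fun _ h => MHat.eq_of_extendsConjugation h MHat.extendsConjugation_derivedModule,
    fun _ _ h => MHat.exists_basis h⟩

end
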